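/- Let $n\ge 0$ and let $m_1,\dots,m_n$ be positive integers; put $\delta=\sqrt{\sum_{i=1}^n m_i^2}$. \textbf{Rays.} Let $p_1,\dots,p_n$ be points of $\mathbb P^2$ over a field $K$, let $X_n$ be the blow-up of $\mathbb P^2$ at these points, with line class $L$ and exceptional divisors $E_1,\dots,E_n$, and write $(d;a_1,\dots,a_n)=dL-\sum a_iE_i$ in $N_1(X_n)=\mathrm{Pic}(X_n)\otimes\mathbb R\cong\mathbb R^{n+1}$, with intersection form $(d;a)\cdot(d';a')=dd'-\sum a_ia_i'$. An integral class $(d;a_1,\dots,a_n)$ is effective if $d\ge 0$ and there is a nonzero form of degree $d$ over $K$ with multiplicity at least $\max(a_i,0)$ at $p_i$ for all $i$. A class is nef if its intersection with every effective class is nonnegative. A ray is a set $[\xi]=\{\lambda\xi:\lambda>0\}$ with $\xi\neq 0$; it is nef if $\xi$ is, rational if it contains a class in $\mathrm{Pic}(X_n)\otimes\mathbb Q$, and effective if it contains an effective class. Let $\mathcal Q_n=\{\xi:\xi\cdot L\ge 0,\ \xi^2\ge 0\}$. A ray contained in $\partial\mathcal Q_n$ is good if it is rational and not effective, and wonderful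 if it is irrational (not rational) and nef. \textbf{Nagata's construction.} Let $F$ be a field, $\mathbf X=(x_{ij})_{1\le i\le 3,\,1\le j\le n}$ a matrix of indeterminates, $k=F(x_{ij})$, and $x_j=[x_{1j},x_{2j},x_{3j}]\in\mathbb P^2_k$. Let $V=\{\mathbf b\in k^n:\mathbf X\mathbf b^t=0\}$ and $H=\{\mathbf c\in(k^*)^n: c_1^{m_1}\cdots c_n^{m_n}=1\}$. Let $G$ be the set $H\times V$, whose elements $\sigma=(\mathbf c,\mathbf b)$ act on the polynomial ring $k[\mathbf u,\mathbf v]=k[u_1,\dots,u_n,v_1,\dots,v_n]$ by the $k$-algebra automorphisms $$\sigma(u_i)=\frac{c_i}{c}(u_i+b_iv_i),\qquad \sigma(v_i)=c_iv_i\qquad(1\le i\le n),\qquad c=c_1\cdots c_n,$$ and let $k[\mathbf u,\mathbf v]^G$ be the $k$-subalgebra of the polynomials fixed by all $\sigma\in G$. \textbf{Theorem.} (1) For every field $F$: if $(\delta;m_1,\dots,m_n)$ generates a good or a wonderful ray on the blow-up of $\mathbb P^2_k$ at the generic points $x_1,\dots,x_n$, then the $k$-algebra $k[\mathbf u,\mathbf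 v]^G$ is not finitely generated. (2) For $F=\mathbb C$: if $(\delta;m_1,\dots,m_n)$ generates a good or a wonderful ray on the blow-up of $\mathbb P^2_{\mathbb C}$ at $n$ very general points (that is, for all $n$-tuples of points whose homogeneous coordinates avoid the zero loci of some countable family of nonzero polynomials), then the $k$-algebra $k[\mathbf u,\mathbf v]^G$, with $k=\mathbb C(x_{ij})$, is not finitely generated. -/

import Mathlib

open MvPolynomial

noncomputable section

namespace NagataRays

/-! ### Linear systems of plane curves and rays on blow-ups of the plane

A point of the projective plane over `K` is given by homogeneous coordinates `a : Fin 3 → K`,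
and an `n`-tuple of points by `p : Fin n → Fin 3 → K`. -/

/-- The form `f` in three variables has multiplicity at least `r` at the point `a`: the Taylor
expansion of `f` at `a` has no terms of degree less than `r`.  (For a form `f` and `a ≠ 0`, the
multiplicity of the affine cone at `a` is that of the plane curve `f = 0` at the point `[a]`.) -/
def HasMultAtLeast {K : Type*} [Field K] (f : MvPolynomial (Fin 3) K) (a : Fin 3 → K) (r : ℕ) :
    Prop :=
  ∀ s : Fin 3 →₀ ℕ, s.degree < r →
    coeff s (aeval (fun i => X i + C (a i) : Fin 3 → MvPolynomial (Fin 3) K) f) = 0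

/-- The integral class `(d; a₁, …, aₙ) = dL - ∑ aᵢ Eᵢ` on the blow-up of the plane at the points
`p₁, …, pₙ` is effective: there is a nonzero form of degree `d` with multiplicity at least `aᵢ`
at `pᵢ`.  A negative `aᵢ` imposes no condition (`Eᵢ` is then a fixed component). -/
def EffectiveClass {K : Type*} [Field K] {n : ℕ} (p : Fin n → Fin 3 → K) (d : ℤ)
    (a : Fin n → ℤ) : Prop :=
  ∃ (e : ℕ) (f : MvPolynomial (Fin 3) K), (e : ℤ) = d ∧ f ≠ 0 ∧ f.IsHomogeneous e ∧
    ∀ j, HasMultAtLeast f (p j) (a j).toNat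

/-- `N₁(Xₙ) = Pic(Xₙ) ⊗ ℝ`, in coordinates with respect to the basis `(L, -E₁, …, -Eₙ)`. -/
abbrev N1 (n : ℕ) : Type := ℝ × (Fin n → ℝ)

/-- The intersection form: `L² = 1`, `Eᵢ² = -1`, all other products of basis elements vanish. -/
def inter {n : ℕ} (ξ η : N1 n) : ℝ := ξ.1 * η.1 - ∑ i, ξ.2 i * η.2 i

/-- The class in `N₁(Xₙ)` of an integral class. -/
def ofInt {n : ℕ} (d : ℤ) (a : Fin n → ℤ) : N1 n := ((d : ℝ), fun i => (a i : ℝ))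

/-- The class in `N₁(Xₙ)` of a rational class. -/
def ofRat {n : ℕ} (d : ℚ) (a : Fin n → ℚ) : N1 n := ((d : ℝ), fun i => (a i : ℝ))

/-- A class is nef if it has nonnegative intersection with every effective class. -/
def NefClass {K : Type*} [Field K] {n : ℕ} (p : Fin n → Fin 3 → K) (ξ : N1 n) : Prop :=
  ∀ (d : ℤ) (a : Fin n → ℤ), EffectiveClass p d a → 0 ≤ inter ξ (ofInt d a)

/-- The set `[ξ]` of positive multiples of `ξ`. -/
def ray {n : ℕ} (ξ : N1 n) : Set (N1 n) := {η | ∃ t : ℝ, 0 < t ∧ η = t • ξ}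

/-- A ray is a set `[ξ]` with `ξ ≠ 0`. -/
def IsRay {n : ℕ} (ρ : Set (N1 n)) : Prop := ∃ ξ : N1 n, ξ ≠ 0 ∧ ρ = ray ξ

/-- A ray is rational if it contains (equivalently, is generated by) a rational class. -/
def RationalRay {n : ℕ} (ρ : Set (N1 n)) : Prop := ∃ (d : ℚ) (a : Fin n → ℚ), ofRat d a ∈ ρ

/-- A ray is effective if it contains (equivalently, is generated by) an effective class. -/
def EffectiveRay {K : Type*} [Field K] {n : ℕ} (p : Fin n → Fin 3 → K) (ρ : Set (N1 n)) : Prop :=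
  ∃ (d : ℤ) (a : Fin n → ℤ), EffectiveClass p d a ∧ ofInt d a ∈ ρ

/-- The nonnegative cone: `ξ · L ≥ 0` and `ξ² ≥ 0`. -/
def nonnegCone (n : ℕ) : Set (N1 n) := {ξ | 0 ≤ inter ξ (ofInt 1 0) ∧ 0 ≤ inter ξ ξ}

/-- A good ray: a rational non-effective ray in the boundary of the nonnegative cone. -/
def IsGoodRay {K : Type*} [Field K] {n : ℕ} (p : Fin n → Fin 3 → K) (ρ : Set (N1 n)) : Prop :=
  IsRay ρ ∧ ρ ⊆ frontier (nonnegCone n) ∧ RationalRay ρ ∧ ¬ EffectiveRay p ρ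

/-- A wonderful ray: an irrational nef ray in the boundary of the nonnegative cone. -/
def IsWonderfulRay {K : Type*} [Field K] {n : ℕ} (p : Fin n → Fin 3 → K) (ρ : Set (N1 n)) :
    Prop :=
  IsRay ρ ∧ ρ ⊆ frontier (nonnegCone n) ∧ ¬ RationalRay ρ ∧ ∀ ξ ∈ ρ, NefClass p ξ

/-- The class `(δ; m₁, …, mₙ)` with `δ = √(∑ mᵢ²)`. -/
def deltaClass {n : ℕ} (m : Fin n → ℕ) : N1 n :=
  (Real.sqrt (∑ i, (m i : ℝ) ^ 2), fun i => (m i : ℝ))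

/-- `P` holds for `n` very general points of the complex projective plane: it holds outside the
zero loci of countably many nonzero polynomials in the homogeneous coordinates. -/
def ForVeryGeneral (n : ℕ) (P : (Fin n → Fin 3 → ℂ) → Prop) : Prop :=
  ∃ S : Set (MvPolynomial (Fin 3 × Fin n) ℂ), S.Countable ∧ (0 ∉ S) ∧
    ∀ p : Fin n → Fin 3 → ℂ, (∀ g ∈ S, eval (fun ij => p ij.2 ij.1) g ≠ 0) → P p

/-! ### Nagata's construction -/

/-- The field `k = F(x_{ij} : 1 ≤ i ≤ 3, 1 ≤ j ≤ n)`. -/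
abbrev GenericField (F : Type*) [Field F] (n : ℕ) : Type _ :=
  FractionRing (MvPolynomial (Fin 3 × Fin n) F)

/-- The matrix `(x_{ij})` of indeterminates, over `k`. -/
def genericMatrix (F : Type*) [Field F] (n : ℕ) : Matrix (Fin 3) (Fin n) (GenericField F n) :=
  Matrix.of fun i j =>
    algebraMap (MvPolynomial (Fin 3 × Fin n) F) (GenericField F n) (X (i, j))

/-- The points `xⱼ = [x_{1j}, x_{2j}, x_{3j}]` of the projective plane over `k`. -/
def genericPoints (F : Type*) [Field F] (n : ℕ) : Fin n → Fin 3 → GenericField F n :=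
  fun j i => genericMatrix F n i j

/-- The subspace `V` of `kⁿ` associated to the points: `b` with `(x_{ij}) b = 0`. -/
def subspaceV (F : Type*) [Field F] (n : ℕ) :
    Submodule (GenericField F n) (Fin n → GenericField F n) :=
  LinearMap.ker (Matrix.mulVecLin (genericMatrix F n))

/-- The subgroup `H` of `(k*)ⁿ`: those `c` with `c₁^{m₁} ⋯ cₙ^{mₙ} = 1`. -/
def subgroupH (F : Type*) [Field F] {n : ℕ} (m : Fin n → ℕ) :
    Subgroup (Fin n → (GenericField F n)ˣ) where
  carrier := {c | ∏ i, c i ^ m i = 1}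
  one_mem' := by simp
  mul_mem' := by
    intro a b ha hb
    simp only [Set.mem_ofPred_eq] at ha hb ⊢
    simp [mul_pow, Finset.prod_mul_distrib, ha, hb]
  inv_mem' := by
    intro a ha
    simp only [Set.mem_ofPred_eq] at ha ⊢
    simp [ha]

/-- The polynomial ring `k[u, v]`, with `uᵢ = X (Sum.inl i)` and `vᵢ = X (Sum.inr i)`. -/
abbrev PolyUV (F : Type*) [Field F] (n : ℕ) : Type _ :=
  MvPolynomial (Fin n ⊕ Fin n) (GenericField F n)

/-- The action of `σ = (c, b)`: with `c = c₁ ⋯ cₙ`,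
`σ(uᵢ) = (cᵢ / c) (uᵢ + bᵢ vᵢ)` and `σ(vᵢ) = cᵢ vᵢ`. -/
def sigma (F : Type*) [Field F] {n : ℕ} (c : Fin n → (GenericField F n)ˣ)
    (b : Fin n → GenericField F n) : PolyUV F n →ₐ[GenericField F n] PolyUV F n :=
  aeval (Sum.elim
    (fun i => C ((c i : GenericField F n) / ∏ j, (c j : GenericField F n)) *
      (X (Sum.inl i) + C (b i) * X (Sum.inr i)))
    (fun i => C (c i : GenericField F n) * X (Sum.inr i)))

/-- The invariant ring `A = k[u, v]^G`: the polynomials fixed by every `σ = (c, b)` with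
`c ∈ H` and `b ∈ V`. -/
def invariantRing (F : Type*) [Field F] {n : ℕ} (m : Fin n → ℕ) :
    Subalgebra (GenericField F n) (PolyUV F n) where
  carrier := {f | ∀ c ∈ subgroupH F m, ∀ b ∈ subspaceV F n, sigma F c b f = f}
  mul_mem' := by
    intro f g hf hg c hc b hb
    rw [map_mul, hf c hc b hb, hg c hc b hb]
  add_mem' := by
    intro f g hf hg c hc b hb
    rw [map_add, hf c hc b hb, hg c hc b hb]
  algebraMap_mem' := by
    intro r c _ b _
    exact AlgHom.commutes _ r

end NagataRays

end

/-!
The monomials of an invariant polynomial are constrained by the torus: since it acts through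
`c₁^{m₁} ⋯ cₙ^{mₙ} = 1`, the numbers `d - deg(uⱼ, vⱼ)`, where `d` is the degree in `u`, are
proportional to `m`. Setting `v = 1` and restricting `u` to the row space of the matrix of points,
invariance under the translations `V` turns each multihomogeneous component into a plane curve of
degree `d` with multiplicity at least `d - deg(uⱼ, vⱼ)` at the `j`-th point. If the ray of
`(δ; m)` is good or wonderful, every such curve with multiplicities `t m`, `t > 0`, has slope
`d / t > δ`. Finitely many generators would therefore bound all these slopes below by some `θ > δ`.
But counting conditions produces a curve `f = 0` with `d < θ t`, and dividing
`f(Y₁, Y₂, Y₃)` by `v₁^{t m₁} ⋯ vₙ^{t mₙ}`, where `Yᵢ = v₁ ⋯ vₙ ∑ⱼ xᵢⱼ uⱼ / vⱼ`, turns it back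
into an invariant, a contradiction.

For very general points, effectiveness over the generic points specializes to the complement of a
hypersurface, so a ray that is good or wonderful at very general points is so at the generic ones.
-/

open scoped Matrix

noncomputable section

namespace NagataRays

/-! ### Multiplicities -/

section Multiplicity

section TaylorExpansion

variable {σ K : Type*} [CommRing K]

/-- The substitution `f(X) ↦ f(X + a)`, whose value at `f` is the Taylor expansion of `f`
at `a`. -/
def translate (a : σ → K) : MvPolynomial σ K →ₐ[K] MvPolynomial σ K :=
  aeval fun i => X i + C (a i)

/-- The polynomial `f(a X₀ + X)`, where `X₀ = X none` is a further variable. For a form `f` it is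
the homogenization of the Taylor expansion of `f` at `a`. -/
def homogenizedTaylor (a : σ → K) (f : MvPolynomial σ K) : MvPolynomial (Option σ) K :=
  aeval (fun i => C (a i) * X none + X (some i)) f

theorem aeval_homogenizedTaylor {R : Type*} [CommRing R] [Algebra K R] (a : σ → K)
    (f : MvPolynomial σ K) (x : Option σ → R) :
    aeval x (homogenizedTaylor a f) = aeval (fun i => a i • x none + x (some i)) f := by
  rw [homogenizedTaylor, ← AlgHom.comp_apply, comp_aeval]
  simp only [map_add, map_mul, aeval_X, aeval_C, Algebra.smul_def]

theorem isHomogeneous_homogenizedTaylor {f : MvPolynomial σ K} {d : ℕ} (hf : f.IsHomogeneous d)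
    (a : σ → K) : (homogenizedTaylor a f).IsHomogeneous d := by
  rw [← one_mul d]
  exact hf.aeval _ fun i =>
    (isHomogeneous_C_mul_X _ _).add (isHomogeneous_X _ _)

theorem translate_eq_aeval_homogenizedTaylor (a : σ → K) (f : MvPolynomial σ K) :
    translate a f = aeval (fun o => o.elim 1 X) (homogenizedTaylor a f) := by
  rw [aeval_homogenizedTaylor, translate]
  simp only [Option.elim_none, Option.elim_some, smul_eq_C_mul, mul_one, add_comm]

theorem degree_eq_none_add_degree_some (s : Option σ →₀ ℕ) :
    s.degree = s none + s.some.degree :=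
  s.sum_option_index (fun _ k => k) (fun _ => rfl) fun _ _ _ => rfl

theorem coeff_some_translate {f : MvPolynomial σ K} {d : ℕ} (hf : f.IsHomogeneous d) (a : σ → K)
    {s : Option σ →₀ ℕ} (hs : s.degree = d) :
    coeff s.some (translate a f) = coeff s (homogenizedTaylor a f) := by
  classical
  have hmon (t : Option σ →₀ ℕ) (c : K) :
      aeval (fun o => o.elim 1 X : Option σ → MvPolynomial σ K) (monomial t c) =
        monomial t.some c := by
    rw [aeval_monomial, monomial_eq, algebraMap_eq,
      Finsupp.prod_option_index _ _ (fun _ => pow_zero _) fun _ _ _ => pow_add _ _ _]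
    simp only [Option.elim_none, Option.elim_some, one_pow, one_mul]
  rw [translate_eq_aeval_homogenizedTaylor, (homogenizedTaylor a f).as_sum, map_sum, coeff_sum,
    coeff_sum]
  refine Finset.sum_congr rfl fun t ht => ?_
  have htd : t.degree = d :=
    ((isHomogeneous_homogenizedTaylor hf a).degree_eq_sum_deg_support ht).symm
  rw [hmon, coeff_monomial, coeff_monomial]
  congr 1
  rw [eq_iff_iff]
  refine ⟨fun h => ?_, fun h => h ▸ rfl⟩
  rw [degree_eq_none_add_degree_some] at hs htd
  ext (_ | i)
  · rw [h] at htd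
    omega
  · exact DFunLike.congr_fun h i

theorem aeval_smul_add_mem_pow {R : Type*} [CommRing R] [Algebra K R] {f : MvPolynomial σ K}
    {d : ℕ} (hf : f.IsHomogeneous d) (a : σ → K) (w : R) {z : σ → R} {I : Ideal R}
    (hz : ∀ i, z i ∈ I) {r : ℕ}
    (h : ∀ e : σ →₀ ℕ, e.degree < r → coeff e (translate a f) = 0 ∨ ∃ i, e i ≠ 0 ∧ z i = 0) :
    aeval (fun i => a i • w + z i) f ∈ I ^ r := by
  have heq := aeval_homogenizedTaylor a f fun o => o.elim w z
  simp only [Option.elim_none, Option.elim_some] at heq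
  rw [← heq, (homogenizedTaylor a f).as_sum, map_sum]
  refine sum_mem fun s hs => ?_
  rw [aeval_monomial,
    Finsupp.prod_option_index _ _ (fun _ => pow_zero _) fun _ _ _ => pow_add _ _ _]
  refine Ideal.mul_mem_left _ _ (Ideal.mul_mem_left _ _ ?_)
  simp only [Option.elim_some]
  rcases lt_or_ge s.some.degree r with hlt | hge
  · have hd := ((isHomogeneous_homogenizedTaylor hf a).degree_eq_sum_deg_support hs).symm
    obtain ⟨i, hi, hzi⟩ := (h _ hlt).resolve_left (by
      rw [coeff_some_translate hf a hd]; exact mem_support_iff.mp hs)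
    rw [Finsupp.prod, Finset.prod_eq_zero (Finsupp.mem_support_iff.mpr hi)
      (by rw [hzi, zero_pow hi])]
    exact zero_mem _
  · refine Ideal.pow_le_pow_right hge ?_
    rw [Finsupp.degree_apply, ← Finset.prod_pow_eq_pow_sum]
    exact Ideal.prod_mem_prod fun i _ => Ideal.pow_mem_pow (hz i) _

end TaylorExpansion

variable {K : Type*} [Field K] {f g : MvPolynomial (Fin 3) K} {a : Fin 3 → K} {r s : ℕ}

theorem hasMultAtLeast_iff_mem :
    HasMultAtLeast f a r ↔ translate a f ∈ idealOfVars (Fin 3) K ^ r :=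
  (mem_pow_idealOfVars_iff' _ _).symm

theorem HasMultAtLeast.mono (h : HasMultAtLeast f a r) (hs : s ≤ r) : HasMultAtLeast f a s :=
  fun e he => h e (he.trans_le hs)

theorem hasMultAtLeast_zero : HasMultAtLeast f a 0 :=
  fun _ he => absurd he (Nat.not_lt_zero _)

theorem HasMultAtLeast.mul (hf : HasMultAtLeast f a r) (hg : HasMultAtLeast g a s) :
    HasMultAtLeast (f * g) a (r + s) := by
  rw [hasMultAtLeast_iff_mem] at *
  rw [map_mul, pow_add]
  exact Ideal.mul_mem_mul hf hg

theorem HasMultAtLeast.pow (hf : HasMultAtLeast f a r) (N : ℕ) :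
    HasMultAtLeast (f ^ N) a (r * N) := by
  rw [hasMultAtLeast_iff_mem] at *
  rw [map_pow, pow_mul]
  exact Ideal.pow_mem_pow hf N

/-- The substitution `X + a` can be written `w a + z` with `w = 1 + X_{i₀} / a_{i₀}` and
`z_{i₀} = 0`, so by homogeneity only the exponents not involving `i₀` matter. -/
theorem HasMultAtLeast.of_coeff {d : ℕ} (hf : f.IsHomogeneous d) {i₀ : Fin 3} (ha : a i₀ ≠ 0)
    (h : ∀ e : Fin 3 →₀ ℕ, e i₀ = 0 → e.degree < r → coeff e (translate a f) = 0) :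
    HasMultAtLeast f a r := by
  set z : Fin 3 → MvPolynomial (Fin 3) K := fun i => X i - C (a i * (a i₀)⁻¹) * X i₀ with hz
  have hX (i : Fin 3) : X i ∈ idealOfVars (Fin 3) K := Ideal.subset_span ⟨i, rfl⟩
  have hsubst : (fun i => X i + C (a i)) = fun i => a i • (1 + C (a i₀)⁻¹ * X i₀) + z i := by
    funext i
    simp only [hz, smul_eq_C_mul, C_mul]
    ring
  rw [hasMultAtLeast_iff_mem, translate, hsubst]
  refine aeval_smul_add_mem_pow hf a _ (fun i => sub_mem (hX i) (Ideal.mul_mem_left _ _ (hX i₀)))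
    fun e he => ?_
  by_cases hi₀ : e i₀ = 0
  · exact Or.inl (h e hi₀ he)
  · refine Or.inr ⟨i₀, hi₀, ?_⟩
    simp only [mul_inv_cancel₀ ha, C_1, one_mul, sub_self]

end Multiplicity

/-! ### Counting conditions on plane curves -/

section Counting

/-- The exponents of degree less than `r` not involving the variable `i₀`: at a point `a` with
`a i₀ ≠ 0` they index the conditions for a form to have multiplicity at least `r`. -/
def transversalExponents (i₀ : Fin 3) (r : ℕ) : Finset (Fin 3 →₀ ℕ) :=
  (Finset.range r).biUnion fun k => Finset.finsuppAntidiag {i₀}ᶜ k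

theorem mem_transversalExponents {i₀ : Fin 3} {r : ℕ} {e : Fin 3 →₀ ℕ} :
    e ∈ transversalExponents i₀ r ↔ e i₀ = 0 ∧ e.degree < r := by
  simp only [transversalExponents, Finset.mem_biUnion, Finset.mem_range,
    Finset.mem_finsuppAntidiag', Finset.subset_compl_comm (s := e.support),
    Finset.singleton_subset_iff, Finset.mem_compl, Finsupp.notMem_support_iff]
  exact ⟨fun ⟨_, hk, hsum, he⟩ => ⟨he, hsum.trans_lt hk⟩, fun ⟨he, hlt⟩ => ⟨_, hlt, rfl, he⟩⟩

theorem two_mul_card_transversalExponents_le (i₀ : Fin 3) (r : ℕ) :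
    2 * (transversalExponents i₀ r).card ≤ r * (r + 1) := by
  have hcard (k : ℕ) : (Finset.finsuppAntidiag ({i₀}ᶜ : Finset (Fin 3)) k).card = k + 1 := by
    rw [Finset.card_finsuppAntidiag_nat_eq_choose, Finset.card_compl, Finset.card_singleton,
      Fintype.card_fin, show 3 - 1 + k - 1 = k + 1 by omega, Nat.choose_succ_self_right]
  calc 2 * (transversalExponents i₀ r).card
      ≤ 2 * ∑ k ∈ Finset.range r, (k + 1) := by
        gcongr
        exact Finset.card_biUnion_le.trans_eq (Finset.sum_congr rfl fun k _ => hcard k)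
    _ = 2 * ∑ k ∈ Finset.range (r + 1), k := by rw [Finset.sum_range_succ']; rfl
    _ = r * (r + 1) := by
        rw [mul_comm, Finset.sum_range_id_mul_two, Nat.add_sub_cancel, mul_comm]

theorem finrank_homogeneousSubmodule (R σ : Type*) [CommRing R] [Nontrivial R] [Fintype σ] (d : ℕ) :
    Module.finrank R (homogeneousSubmodule σ R d) = (Fintype.card σ).multichoose d := by
  classical
  have hset : {e : σ →₀ ℕ | e.degree = d} = Finset.finsuppAntidiag (Finset.univ : Finset σ) d := by
    ext e
    simp only [Set.mem_ofPred_eq, SetLike.mem_coe, Finset.mem_finsuppAntidiag,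
      Finset.subset_univ, and_true, Finsupp.degree_eq_sum]
  rw [homogeneousSubmodule_eq_finsupp_supported, hset,
    (AddMonoidAlgebra.supportedEquivFinsupp _).finrank_eq, Module.finrank_finsupp_self,
    ← Finset.card_univ (α := σ), ← Finset.card_finsuppAntidiag_nat_eq_multichoose]
  exact Fintype.card_coe _

variable {K : Type*} [Field K] {n : ℕ} {p : Fin n → Fin 3 → K}

theorem effectiveClass_of_sum_lt (hp : ∀ j, p j ≠ 0) {d : ℕ} {r : Fin n → ℕ}
    (h : ∑ j, r j * (r j + 1) < (d + 1) * (d + 2)) : EffectiveClass p d (fun j => r j) := by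
  choose i₀ hi₀ using fun j => Function.ne_iff.mp (hp j)
  let conditions : homogeneousSubmodule (Fin 3) K d →ₗ[K]
      ((Σ j, transversalExponents (i₀ j) (r j)) → K) :=
    LinearMap.pi fun c =>
      (lcoeff K c.2.1) ∘ₗ (translate (p c.1)).toLinearMap ∘ₗ Submodule.subtype _
  have : FiniteDimensional K (homogeneousSubmodule (Fin 3) K d) :=
    Module.Finite.iff_fg.mpr (homogeneousSubmodule_fg _ _ d)
  have hlt : Module.finrank K ((Σ j, transversalExponents (i₀ j) (r j)) → K) <
      Module.finrank K (homogeneousSubmodule (Fin 3) K d) := by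
    have hforms : 2 * Nat.multichoose 3 d = (d + 1) * (d + 2) := by
      rw [Nat.multichoose_eq, show 3 + d - 1 = d + 2 by omega, Nat.choose_symm_add,
        Nat.choose_two_right, Nat.mul_div_cancel' (Nat.even_mul_pred_self _).two_dvd]
      exact mul_comm _ _
    have hconditions : 2 * ∑ j, (transversalExponents (i₀ j) (r j)).card ≤
        ∑ j, r j * (r j + 1) := by
      rw [Finset.mul_sum]
      exact Finset.sum_le_sum fun j _ => two_mul_card_transversalExponents_le _ _
    rw [finrank_homogeneousSubmodule, Module.finrank_fintype_fun_eq_card, Fintype.card_sigma]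
    simp only [Fintype.card_coe, Fintype.card_fin]
    omega
  obtain ⟨⟨f, hf⟩, hker, hf0⟩ :=
    (Submodule.ne_bot_iff _).mp (LinearMap.ker_ne_bot_of_finrank_lt (f := conditions) hlt)
  refine ⟨d, f, rfl, fun h0 => hf0 (Subtype.ext h0), hf, fun j => ?_⟩
  refine HasMultAtLeast.of_coeff hf (hi₀ j) fun e he hdeg => ?_
  exact congrFun hker ⟨j, e, mem_transversalExponents.mpr ⟨he, hdeg⟩⟩

theorem deltaClass_fst_nonneg (m : Fin n → ℕ) : 0 ≤ (deltaClass m).1 :=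
  Real.sqrt_nonneg _

theorem deltaClass_fst_sq (m : Fin n → ℕ) : (deltaClass m).1 ^ 2 = ∑ i, (m i : ℝ) ^ 2 :=
  Real.sq_sqrt (by positivity)

/-- The expected dimension of the linear system `(d; t m)` grows like `(d² - t² δ²) / 2`. -/
theorem exists_effectiveClass_lt (hp : ∀ j, p j ≠ 0) (m : Fin n → ℕ) {θ : ℝ}
    (hθ : (deltaClass m).1 < θ) :
    ∃ t d : ℕ, (d : ℝ) < θ * t ∧ EffectiveClass p d (fun j => ((t * m j : ℕ) : ℤ)) := by
  have hδ0 := deltaClass_fst_nonneg m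
  have hδ2 := deltaClass_fst_sq m
  set δ := (deltaClass m).1
  obtain ⟨η, hδη, hηθ⟩ := exists_between hθ
  have hη : 0 < η := hδ0.trans_lt hδη
  have hgap : 0 < η ^ 2 - δ ^ 2 := by nlinarith
  set M : ℝ := ∑ i, (m i : ℝ) with hM
  obtain ⟨t, ht⟩ := exists_nat_gt (max (1 / (θ - η)) (M / (η ^ 2 - δ ^ 2)))
  obtain ⟨hround, hdominate⟩ := max_lt_iff.mp ht
  rw [div_lt_iff₀ (sub_pos.mpr hηθ)] at hround
  rw [div_lt_iff₀ hgap] at hdominate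
  have hceil : (⌈η * t⌉₊ : ℝ) < η * t + 1 := Nat.ceil_lt_add_one (by positivity)
  refine ⟨t, ⌈η * t⌉₊, by linarith, effectiveClass_of_sum_lt hp ?_⟩
  rify
  calc ∑ j, (t * m j : ℝ) * (t * m j + 1) = t * (t * δ ^ 2 + M) := by
        rw [hδ2, hM, Finset.mul_sum, ← Finset.sum_add_distrib, Finset.mul_sum]
        exact Finset.sum_congr rfl fun j _ => by ring
    _ ≤ t * (t * η ^ 2) := by
        gcongr
        linarith
    _ = (η * t) ^ 2 := by ring
    _ ≤ (⌈η * t⌉₊ : ℝ) ^ 2 := by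
        gcongr
        exact Nat.le_ceil _
    _ < (⌈η * t⌉₊ + 1 : ℝ) * (⌈η * t⌉₊ + 2) := by nlinarith [Nat.cast_nonneg (α := ℝ) ⌈η * t⌉₊]

end Counting

/-! ### Good and wonderful rays -/

section Rays

variable {K : Type*} [Field K] {n : ℕ} {p : Fin n → Fin 3 → K}

theorem EffectiveClass.mono {d : ℤ} {a b : Fin n → ℤ} (h : EffectiveClass p d a)
    (hba : ∀ j, b j ≤ a j) : EffectiveClass p d b := by
  obtain ⟨e, f, he, hf0, hf, hmult⟩ := h
  exact ⟨e, f, he, hf0, hf, fun j => (hmult j).mono (Int.toNat_le_toNat (hba j))⟩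

theorem EffectiveClass.nsmul_add {d : ℤ} {a : Fin n → ℤ} (h : EffectiveClass p d a) (N s : ℕ) :
    EffectiveClass p (N * d + s) (fun j => N * a j) := by
  obtain ⟨e, f, rfl, hf0, hf, hmult⟩ := h
  refine ⟨e * N + 1 * s, f ^ N * X 0 ^ s, by push_cast; ring, mul_ne_zero (pow_ne_zero _ hf0)
    (pow_ne_zero _ (X_ne_zero _)), (hf.pow N).mul ((isHomogeneous_X K 0).pow s), fun j => ?_⟩
  refine (((hmult j).pow N).mul hasMultAtLeast_zero).mono ?_
  rw [Int.toNat_le]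
  push_cast
  nlinarith [Int.self_le_toNat (a j)]

theorem hasMultAtLeast_one_of_eval_eq_zero {f : MvPolynomial (Fin 3) K} {a : Fin 3 → K}
    (h : eval a f = 0) : HasMultAtLeast f a 1 := by
  intro s hs
  obtain rfl : s = 0 := s.degree_eq_zero_iff.mp (Nat.lt_one_iff.mp hs)
  rw [← h, ← constantCoeff_eq, map_aeval, algebraMap_eq, constantCoeff_comp_C, eval]
  simp only [map_add, constantCoeff_X, constantCoeff_C, zero_add]

theorem effectiveClass_line {ℓ : Fin 3 → K} (hℓ : ℓ ≠ 0) (h : ∀ j, p j ⬝ᵥ ℓ = 0) :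
    EffectiveClass p 1 (fun _ => 1) := by
  refine ⟨1, ∑ i, C (ℓ i) * X i, rfl, fun h0 => hℓ (funext fun i => ?_),
    IsHomogeneous.sum _ _ _ fun i _ => isHomogeneous_C_mul_X _ _, fun j => ?_⟩
  · simpa [coeff_sum, coeff_C_mul, coeff_X, Finsupp.single_left_inj] using
      congrArg (coeff (Finsupp.single i 1)) h0
  · refine hasMultAtLeast_one_of_eval_eq_zero ?_
    rw [← h j, dotProduct]
    simp only [map_sum, map_mul, eval_C, eval_X, mul_comm]

variable {m : Fin n → ℕ}

theorem natCast_le_deltaClass_fst (m : Fin n → ℕ) (j : Fin n) : (m j : ℝ) ≤ (deltaClass m).1 :=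
  Real.le_sqrt_of_sq_le (Finset.single_le_sum (f := fun i => (m i : ℝ) ^ 2)
    (fun _ _ => by positivity) (Finset.mem_univ j))

theorem rationalRay_deltaClass_iff :
    RationalRay (ray (deltaClass m)) ↔ ¬ Irrational (deltaClass m).1 := by
  rw [Irrational, not_not]
  constructor
  · rintro ⟨q, b, t, ht, h⟩
    by_cases hm : m = 0
    · exact ⟨0, by simp [hm, deltaClass]⟩
    obtain ⟨j, hj⟩ := Function.ne_iff.mp hm
    have hd : (q : ℝ) = t * (deltaClass m).1 := congrArg Prod.fst h
    have hb : (b j : ℝ) = t * m j := congrFun (congrArg Prod.snd h) j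
    have hmj : (m j : ℝ) ≠ 0 := Nat.cast_ne_zero.mpr hj
    refine ⟨q * m j / b j, ?_⟩
    push_cast
    rw [hd, hb]
    field_simp
  · rintro ⟨q, hq⟩
    refine ⟨q, fun j => m j, 1, one_pos, ?_⟩
    rw [one_smul]
    exact Prod.ext hq (funext fun j => Rat.cast_natCast _)

theorem IsGoodRay.delta_mul_lt (h : IsGoodRay p (ray (deltaClass m))) {d : ℤ} {a : Fin n → ℤ}
    (hda : EffectiveClass p d a) {N A : ℕ} (hA : 0 < A) (hma : ∀ j, (A * m j : ℤ) ≤ N * a j) :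
    (deltaClass m).1 * A < N * d := by
  obtain ⟨-, -, hrat, hne⟩ := h
  obtain ⟨q, hq⟩ := not_not.mp (rationalRay_deltaClass_iff.mp hrat)
  lift q to ℚ≥0 using by exact_mod_cast hq ▸ deltaClass_fst_nonneg m
  have hxy : (q.den : ℝ) * (deltaClass m).1 = q.num := by
    rw [← hq]
    exact_mod_cast q.den_mul_eq_num
  by_contra! hle
  have hscaled : (q.den * N : ℕ) * d ≤ (q.num * A : ℕ) := by
    rify
    rw [← hxy]
    nlinarith [mul_le_mul_of_nonneg_left hle q.den.cast_nonneg]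
  obtain ⟨s, hs⟩ := Int.le.dest hscaled
  refine hne ⟨_, _, (hda.nsmul_add (q.den * N) s).mono (b := fun j => q.den * A * m j)
    fun j => ?_, q.den * A, by positivity, Prod.ext ?_ (funext fun j => ?_)⟩
  · push_cast
    nlinarith [hma j]
  · simp only [ofInt, hs]
    push_cast
    rw [← hxy]
    exact mul_right_comm _ _ _
  · simp only [ofInt]
    push_cast
    rfl

theorem IsWonderfulRay.delta_mul_lt (h : IsWonderfulRay p (ray (deltaClass m))) {d : ℤ}
    {a : Fin n → ℤ} (hda : EffectiveClass p d a) {N A : ℕ} (hA : 0 < A)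
    (hma : ∀ j, (A * m j : ℤ) ≤ N * a j) : (deltaClass m).1 * A < N * d := by
  obtain ⟨-, -, hirr, hnef⟩ := h
  rw [rationalRay_deltaClass_iff, not_not] at hirr
  have hnef : 0 ≤ inter (deltaClass m) (ofInt d a) :=
    hnef _ ⟨1, one_pos, (one_smul ℝ _).symm⟩ d a hda
  have hδ : 0 < (deltaClass m).1 := (deltaClass_fst_nonneg m).lt_of_ne' hirr.ne_zero
  have hAR : (0 : ℝ) < A := Nat.cast_pos.mpr hA
  have hle : (deltaClass m).1 * ((deltaClass m).1 * A) ≤ (deltaClass m).1 * (N * d) :=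
    calc (deltaClass m).1 * ((deltaClass m).1 * A) = ∑ j, m j * (A * m j : ℝ) := by
          rw [← mul_assoc, ← sq, deltaClass_fst_sq, Finset.sum_mul]
          exact Finset.sum_congr rfl fun j _ => by ring
      _ ≤ ∑ j, m j * (N * a j : ℝ) := by
          gcongr ∑ j, _ * ?_ with j
          exact_mod_cast hma j
      _ = N * ∑ j, (m j : ℝ) * a j := by
          rw [Finset.mul_sum]
          exact Finset.sum_congr rfl fun j _ => by ring
      _ ≤ N * ((deltaClass m).1 * d) := by
          gcongr
          exact sub_nonneg.mp hnef
      _ = (deltaClass m).1 * (N * d) := by ring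
  refine (le_of_mul_le_mul_left hle hδ).lt_of_ne fun heq => hirr ⟨N * d / A, ?_⟩
  push_cast
  rw [← heq, mul_div_cancel_right₀ _ hAR.ne']

theorem delta_mul_lt_of_effectiveClass
    (h : IsGoodRay p (ray (deltaClass m)) ∨ IsWonderfulRay p (ray (deltaClass m))) {d : ℤ}
    {a : Fin n → ℤ} (hda : EffectiveClass p d a) {N A : ℕ} (hA : 0 < A)
    (hma : ∀ j, (A * m j : ℤ) ≤ N * a j) : (deltaClass m).1 * A < N * d :=
  h.elim (fun h => h.delta_mul_lt hda hA hma) fun h => h.delta_mul_lt hda hA hma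

theorem not_effectiveClass_line
    (h : IsGoodRay p (ray (deltaClass m)) ∨ IsWonderfulRay p (ray (deltaClass m))) :
    ¬ EffectiveClass p 1 (fun _ => 1) := by
  intro hline
  have hfloor (j : Fin n) : m j ≤ ⌊(deltaClass m).1⌋₊ :=
    Nat.le_floor (natCast_le_deltaClass_fst m j)
  have hlt := delta_mul_lt_of_effectiveClass h hline (N := ⌊(deltaClass m).1⌋₊) one_pos
    fun j => by simpa using hfloor j
  push_cast at hlt
  linarith [Nat.floor_le (deltaClass_fst_nonneg m)]

theorem exists_leftInverse_points
    (h : IsGoodRay p (ray (deltaClass m)) ∨ IsWonderfulRay p (ray (deltaClass m))) :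
    ∃ Z : Matrix (Fin 3) (Fin n) K, Z * Matrix.of p = 1 := by
  have hker : LinearMap.ker (Matrix.of p).toLin' = ⊥ := by
    refine LinearMap.ker_eq_bot'.mpr fun ℓ hℓ => ?_
    by_contra hℓ0
    exact not_effectiveClass_line h (effectiveClass_line hℓ0 fun j => congrFun hℓ j)
  obtain ⟨Z, hZ⟩ := LinearMap.exists_leftInverse_of_injective _ hker
  refine ⟨LinearMap.toMatrix' Z, ?_⟩
  rw [← LinearMap.toMatrix'_toLin' (Matrix.of p), ← LinearMap.toMatrix'_comp, hZ,
    LinearMap.toMatrix'_id]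

end Rays

/-! ### Weighted homogeneous components and substitutions -/

section Weighted

theorem eval_aeval {σ τ R : Type*} [CommSemiring R] (y : τ → R) (h : σ → MvPolynomial τ R)
    (g : MvPolynomial σ R) : eval y (aeval h g) = eval (fun x => eval y (h x)) g := by
  simp only [← coe_aeval_eq_eval]
  exact DFunLike.congr_fun (comp_aeval h (aeval y)) g

theorem aeval_isWeightedHomogeneous {σ τ R M : Type*} [CommSemiring R] [AddCommMonoid M]
    {w : σ → M} {w' : τ → M} {g : MvPolynomial σ R} {d : M} (hg : IsWeightedHomogeneous w g d)
    {h : σ → MvPolynomial τ R} (hh : ∀ x, IsWeightedHomogeneous w' (h x) (w x)) :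
    IsWeightedHomogeneous w' (aeval h g) d := by
  rw [g.as_sum, map_sum]
  refine IsWeightedHomogeneous.sum _ _ _ fun e he => ?_
  rw [aeval_monomial, algebraMap_eq, ← hg (mem_support_iff.mp he), Finsupp.weight_apply]
  exact (IsWeightedHomogeneous.prod _ _ _ fun x _ => (hh x).pow _).C_mul _

theorem aeval_mem_ideal_pow {σ R S : Type*} [CommSemiring R] [CommSemiring S] [Algebra R S]
    {I : Ideal S} {h : σ → S} {w : σ → ℕ} (hh : ∀ x, h x ∈ I ^ w x) {g : MvPolynomial σ R}
    {r : ℕ} (hg : ∀ μ ∈ g.support, r ≤ Finsupp.weight w μ) : aeval h g ∈ I ^ r := by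
  rw [g.as_sum, map_sum]
  refine sum_mem fun μ hμ => ?_
  rw [aeval_monomial]
  refine Ideal.mul_mem_left _ _ (Ideal.pow_le_pow_right (hg μ hμ) ?_)
  rw [Finsupp.weight_apply, Finsupp.sum, ← Finset.prod_pow_eq_pow_sum]
  refine Ideal.prod_mem_prod fun x _ => ?_
  rw [smul_eq_mul, mul_comm, pow_mul]
  exact Ideal.pow_mem_pow (hh x) _

section Torus

variable {σ τ R : Type*} [CommSemiring R] (w : σ → τ →₀ ℕ)

theorem aeval_monomial_weight (p : σ → R) (s : σ →₀ ℕ) (c : R) :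
    aeval (fun x => monomial (w x) (p x)) (monomial s c) =
      monomial (Finsupp.weight w s) (eval p (monomial s c)) := by
  have hprod : (s.prod fun x k => monomial (w x) (p x) ^ k) =
      monomial (Finsupp.weight w s) (s.prod fun x k => p x ^ k) := by
    rw [Finsupp.weight_apply, Finsupp.sum, ← mul_one (s.prod fun x k => p x ^ k),
      ← C_mul_monomial, monomial_sum_one, Finsupp.prod, Finsupp.prod, map_prod,
      ← Finset.prod_mul_distrib]
    simp only [monomial_pow, C_mul_monomial, mul_one]
  rw [aeval_monomial, hprod, algebraMap_eq, C_mul_monomial, eval_monomial]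

theorem coeff_aeval_monomial_weight (p : σ → R) (f : MvPolynomial σ R) (ν : τ →₀ ℕ) :
    coeff ν (aeval (fun x => monomial (w x) (p x)) f) =
      eval p (weightedHomogeneousComponent w ν f) := by
  classical
  induction f using induction_on' with
  | monomial s c =>
    rw [aeval_monomial_weight, coeff_monomial]
    split_ifs with hs
    · rw [weightedHomogeneousComponent_eq_self (isWeightedHomogeneous_monomial w s c hs)]
    · rw [(isWeightedHomogeneous_monomial w s c rfl).weightedHomogeneousComponent_ne _
        (Ne.symm hs), map_zero]
  | add f g hf hg => rw [map_add, coeff_add, hf, hg, map_add, map_add]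

theorem eval_aeval_monomial_weight (t : τ → R) (p : σ → R) (f : MvPolynomial σ R) :
    eval t (aeval (fun x => monomial (w x) (p x)) f) =
      eval (fun x => p x * (w x).prod fun i k => t i ^ k) f := by
  simp only [eval_aeval, eval_monomial]

variable {w}

theorem eval_mul_weight_of_isWeightedHomogeneous {f : MvPolynomial σ R} {ν : τ →₀ ℕ}
    (hf : IsWeightedHomogeneous w f ν) (t : τ → R) (p : σ → R) :
    eval (fun x => p x * (w x).prod fun i k => t i ^ k) f =
      eval p f * ν.prod fun i k => t i ^ k := by
  have hmono : aeval (fun x => monomial (w x) (p x)) f = monomial ν (eval p f) := by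
    classical
    ext κ
    rw [coeff_aeval_monomial_weight, coeff_monomial]
    split_ifs with hκ
    · rw [weightedHomogeneousComponent_eq_self (hκ ▸ hf)]
    · rw [hf.weightedHomogeneousComponent_ne _ (Ne.symm hκ), map_zero]
  rw [← eval_aeval_monomial_weight, hmono, eval_monomial]

end Torus

theorem eval_weightedHomogeneousComponent_congr {σ τ K : Type*} [Field K] [Infinite K]
    {w : σ → τ →₀ ℕ} {f : MvPolynomial σ K} {p q : σ → K}
    (h : ∀ t : τ → K, (∀ i, t i ≠ 0) →
      eval (fun x => p x * (w x).prod fun i k => t i ^ k) f =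
        eval (fun x => q x * (w x).prod fun i k => t i ^ k) f) (ν : τ →₀ ℕ) :
    eval p (weightedHomogeneousComponent w ν f) = eval q (weightedHomogeneousComponent w ν f) := by
  rw [← coeff_aeval_monomial_weight, ← coeff_aeval_monomial_weight]
  congr 1
  refine funext_set (fun _ => {0}ᶜ) (fun _ => (Set.finite_singleton 0).infinite_compl)
    fun t ht => ?_
  rw [eval_aeval_monomial_weight, eval_aeval_monomial_weight]
  exact h t fun i => ht i trivial

theorem coeff_aeval_C_mul_X {σ R : Type*} [CommSemiring R] (χ : σ → R) (f : MvPolynomial σ R)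
    (μ : σ →₀ ℕ) :
    coeff μ (aeval (fun x => C (χ x) * X x) f) = coeff μ f * μ.prod fun x k => χ x ^ k := by
  classical
  have hweight (s : σ →₀ ℕ) : Finsupp.weight (fun x => Finsupp.single x 1) s = s := by
    simp only [Finsupp.weight_apply, Finsupp.smul_single_one, Finsupp.sum_single]
  have hcomponent : weightedHomogeneousComponent (fun x => Finsupp.single x 1) μ f =
      monomial μ (coeff μ f) := by
    ext s
    rw [coeff_weightedHomogeneousComponent, hweight, coeff_monomial]
    split_ifs with h₁ h₂ h₂
    · rw [h₁]
    · exact absurd h₁.symm h₂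
    · exact absurd h₂.symm h₁
    · rfl
  simp only [C_mul_X_eq_monomial]
  rw [coeff_aeval_monomial_weight, hcomponent, eval_monomial]

end Weighted

/-! ### Plane curves from translation-invariant polynomials -/

section Curves

variable {K : Type*} [Field K] {n : ℕ} {p : Fin n → Fin 3 → K}

/-- Invariance of `g(u, v)` under the substitutions `uᵢ ↦ uᵢ + bᵢ vᵢ` for the linear relations `b`
between the points `p`, as an identity of polynomial functions. -/
def TranslationInvariant (p : Fin n → Fin 3 → K) (g : MvPolynomial (Fin n ⊕ Fin n) K) : Prop :=
  ∀ u v b : Fin n → K, b ᵥ* Matrix.of p = 0 →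
    eval (Sum.elim (u + b * v) v) g = eval (Sum.elim u v) g

/-- The grading of `K[u, v]` by `ℕ × ℕⁿ` for which `none` records the degree in `u` and `some i`
the degree in `uᵢ` and `vᵢ` together. -/
def multidegree (n : ℕ) : Fin n ⊕ Fin n → Option (Fin n) →₀ ℕ :=
  Sum.elim (fun i => Finsupp.single none 1 + Finsupp.single (some i) 1)
    (fun i => Finsupp.single (some i) 1)

theorem weight_multidegree_none (μ : Fin n ⊕ Fin n →₀ ℕ) :
    Finsupp.weight (multidegree n) μ none = ∑ i, μ (Sum.inl i) := by
  simp [Finsupp.weight_apply, Finsupp.sum_fintype, multidegree]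

theorem weight_multidegree_some (μ : Fin n ⊕ Fin n →₀ ℕ) (j : Fin n) :
    Finsupp.weight (multidegree n) μ (some j) = μ (Sum.inl j) + μ (Sum.inr j) := by
  simp [Finsupp.weight_apply, Finsupp.sum_fintype, multidegree,
    Finsupp.single_apply]

theorem elim_mul_prod_multidegree (t : Option (Fin n) → K) (u v : Fin n → K) :
    (fun x => Sum.elim u v x * (multidegree n x).prod fun i k => t i ^ k) =
      Sum.elim (fun i => u i * (t none * t (some i))) (fun i => v i * t (some i)) := by
  funext x
  cases x <;> simp [multidegree, Finsupp.prod_add_index', pow_add]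

theorem translationInvariant_weightedHomogeneousComponent [Infinite K]
    {g : MvPolynomial (Fin n ⊕ Fin n) K} (hg : TranslationInvariant p g)
    (ν : Option (Fin n) →₀ ℕ) :
    TranslationInvariant p (weightedHomogeneousComponent (multidegree n) ν g) := by
  intro u v b hb
  refine eval_weightedHomogeneousComponent_congr (fun t _ => ?_) ν
  rw [elim_mul_prod_multidegree, elim_mul_prod_multidegree,
    ← hg (fun i => u i * (t none * t (some i))) (fun i => v i * t (some i)) (t none • b)
      (by rw [Matrix.smul_vecMul, hb, smul_zero])]
  congr 3
  funext i
  simp only [Pi.add_apply, Pi.mul_apply, Pi.smul_apply, smul_eq_mul]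
  ring

/-- The form in three variables obtained from `g(u, v)` by setting `v = 1` and letting `u` run
through the row space of `Z`. -/
def curveForm (Z : Matrix (Fin 3) (Fin n) K) (g : MvPolynomial (Fin n ⊕ Fin n) K) :
    MvPolynomial (Fin 3) K :=
  aeval (Sum.elim (fun j => ∑ i, C (Z i j) * X i) 1) g

variable {Z : Matrix (Fin 3) (Fin n) K} {g : MvPolynomial (Fin n ⊕ Fin n) K}
  {ν : Option (Fin n) →₀ ℕ}

theorem eval_curveForm (y : Fin 3 → K) :
    eval y (curveForm Z g) = eval (Sum.elim (y ᵥ* Z) 1) g := by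
  rw [curveForm, eval_aeval]
  congr 2
  funext x
  rcases x with j | j
  · simp [Matrix.vecMul, dotProduct, mul_comm]
  · simp

theorem isHomogeneous_curveForm (hg : IsWeightedHomogeneous (multidegree n) g ν) :
    (curveForm Z g).IsHomogeneous (ν none) := by
  have hu : IsWeightedHomogeneous (Sum.elim 1 0 : Fin n ⊕ Fin n → ℕ) g (ν none) := by
    intro μ hμ
    rw [← hg hμ, weight_multidegree_none]
    simp [Finsupp.weight_apply, Finsupp.sum_fintype]
  refine aeval_isWeightedHomogeneous hu fun x => ?_
  rcases x with j | _
  · exact IsHomogeneous.sum _ _ _ fun i _ => isHomogeneous_C_mul_X _ _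
  · exact isHomogeneous_one _ _

theorem curveForm_ne_zero [Infinite K] (hZ : Z * Matrix.of p = 1) (hg : TranslationInvariant p g)
    (hν : IsWeightedHomogeneous (multidegree n) g ν) (hg0 : g ≠ 0) : curveForm Z g ≠ 0 := by
  obtain ⟨x, hx⟩ : ∃ x, eval x (g * ∏ j, X (Sum.inr j)) ≠ 0 := by
    by_contra! h
    exact mul_ne_zero hg0 (Finset.prod_ne_zero_iff.mpr fun j _ => X_ne_zero (Sum.inr j))
      (MvPolynomial.funext fun x => (h x).trans (map_zero _).symm)
  simp only [map_mul, map_prod, eval_X, ne_eq, mul_eq_zero, not_or,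
    Finset.prod_eq_zero_iff, Finset.mem_univ, true_and, not_exists] at hx
  obtain ⟨hgx, hv⟩ := hx
  set q : Fin n → K := fun j => x (Sum.inl j) / x (Sum.inr j) with hq
  have hxq : x = fun y => Sum.elim q 1 y * (multidegree n y).prod fun i k =>
      (i.elim 1 fun j => x (Sum.inr j)) ^ k := by
    rw [elim_mul_prod_multidegree]
    funext y
    rcases y with j | j
    · simp [q, div_mul_cancel₀ _ (hv j)]
    · simp
  have hgq : eval (Sum.elim q 1) g ≠ 0 := by
    rw [hxq, eval_mul_weight_of_isWeightedHomogeneous hν] at hgx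
    exact left_ne_zero_of_mul hgx
  have hrel : (q ᵥ* Matrix.of p ᵥ* Z - q) ᵥ* Matrix.of p = 0 := by
    rw [Matrix.sub_vecMul, Matrix.vecMul_vecMul, hZ, Matrix.vecMul_one, sub_self]
  intro h0
  refine hgq ?_
  rw [← hg q 1 _ hrel, mul_one, add_sub_cancel, ← eval_curveForm, h0, map_zero]

theorem translate_curveForm [Infinite K] (hZ : Z * Matrix.of p = 1)
    (hg : TranslationInvariant p g) (j : Fin n) :
    translate (p j) (curveForm Z g) =
      aeval (Sum.elim (fun l => ∑ i, C (Z i l) * X i + C ((Pi.single j 1 : Fin n → K) l)) 1) g := by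
  refine MvPolynomial.funext fun y => ?_
  have hrel : (Pi.single j 1 - p j ᵥ* Z) ᵥ* Matrix.of p = 0 := by
    rw [Matrix.sub_vecMul, Matrix.vecMul_vecMul, hZ, Matrix.vecMul_one, Matrix.single_one_vecMul]
    exact sub_self _
  have hrow : (y + p j) ᵥ* Z + (Pi.single j 1 - p j ᵥ* Z) = y ᵥ* Z + Pi.single j 1 := by
    rw [Matrix.add_vecMul]
    abel
  rw [translate, eval_aeval, eval_aeval]
  have hshift : (fun i => eval y (X i + C (p j i))) = y + p j := by
    funext i
    simp
  rw [hshift, eval_curveForm, ← hg _ 1 _ hrel, mul_one, hrow]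
  congr 2
  funext x
  rcases x with l | l
  · simp [Matrix.vecMul, dotProduct, mul_comm]
  · simp

theorem hasMultAtLeast_curveForm [Infinite K] (hZ : Z * Matrix.of p = 1)
    (hg : TranslationInvariant p g) (hν : IsWeightedHomogeneous (multidegree n) g ν) (j : Fin n) :
    HasMultAtLeast (curveForm Z g) (p j) (ν none - ν (some j)) := by
  classical
  rw [hasMultAtLeast_iff_mem, translate_curveForm hZ hg]
  refine aeval_mem_ideal_pow (w := Sum.elim (fun l => if l = j then 0 else 1) 0)
    (fun x => ?_) fun μ hμ => ?_
  · rcases x with l | l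
    · rcases eq_or_ne l j with rfl | hl
      · simp
      · simp only [Sum.elim_inl, if_neg hl, Pi.single_eq_of_ne hl, map_zero, add_zero, pow_one]
        exact sum_mem fun i _ => Ideal.mul_mem_left _ _ (Ideal.subset_span ⟨i, rfl⟩)
    · simp
  · have hweight : Finsupp.weight (Sum.elim (fun l => if l = j then 0 else 1) 0) μ +
        μ (Sum.inl j) = ∑ l, μ (Sum.inl l) := by
      rw [← Finset.sum_erase_add _ _ (Finset.mem_univ j)]
      simp [Finsupp.weight_apply, Finsupp.sum_fintype, Finset.sum_ite, Finset.filter_ne']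
    rw [← hν (mem_support_iff.mp hμ), weight_multidegree_none, weight_multidegree_some]
    omega

theorem TranslationInvariant.effectiveClass [Infinite K] (hg : TranslationInvariant p g)
    (hZ : Z * Matrix.of p = 1) {μ : Fin n ⊕ Fin n →₀ ℕ} (hμ : μ ∈ g.support) :
    EffectiveClass p (∑ i, μ (Sum.inl i) : ℕ)
      (fun j => (∑ i, μ (Sum.inl i) : ℕ) - (μ (Sum.inl j) + μ (Sum.inr j) : ℕ)) := by
  classical
  set ν := Finsupp.weight (multidegree n) μ with hν
  have hcomp := translationInvariant_weightedHomogeneousComponent hg ν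
  have hhom := weightedHomogeneousComponent_isWeightedHomogeneous (w := multidegree n) ν g
  have hne : weightedHomogeneousComponent (multidegree n) ν g ≠ 0 := by
    refine ne_zero_iff.mpr ⟨μ, ?_⟩
    rw [coeff_weightedHomogeneousComponent, if_pos rfl]
    exact mem_support_iff.mp hμ
  refine ⟨ν none, curveForm Z _, by rw [hν, weight_multidegree_none],
    curveForm_ne_zero hZ hcomp hhom hne, isHomogeneous_curveForm hhom, fun j => ?_⟩
  rw [Int.toNat_sub, ← weight_multidegree_none, ← weight_multidegree_some]
  exact hasMultAtLeast_curveForm hZ hcomp hhom j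

end Curves

/-! ### Nagata's group action -/

section Invariants

variable {K : Type*} [Field K] {n : ℕ}

/-- The automorphism `uᵢ ↦ (cᵢ / c) (uᵢ + bᵢ vᵢ)`, `vᵢ ↦ cᵢ vᵢ` of `K[u, v]`, where
`c = c₁ ⋯ cₙ`: Nagata's action over an arbitrary field. -/
def nagataAction (c : Fin n → Kˣ) (b : Fin n → K) :
    MvPolynomial (Fin n ⊕ Fin n) K →ₐ[K] MvPolynomial (Fin n ⊕ Fin n) K :=
  aeval (Sum.elim
    (fun i => C ((c i : K) / ∏ j, (c j : K)) * (X (Sum.inl i) + C (b i) * X (Sum.inr i)))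
    (fun i => C (c i : K) * X (Sum.inr i)))

/-- The invariants of Nagata's action attached to points `p` with weights `m`: the translations
`b` run over the linear relations between the points, and the torus elements `c` over those with
`c₁^{m₁} ⋯ cₙ^{mₙ} = 1`. -/
def nagataInvariants (p : Fin n → Fin 3 → K) (m : Fin n → ℕ) :
    Subalgebra K (MvPolynomial (Fin n ⊕ Fin n) K) :=
  ⨅ (c : Fin n → Kˣ) (_ : ∏ i, c i ^ m i = 1) (b : Fin n → K) (_ : b ᵥ* Matrix.of p = 0),
    AlgHom.equalizer (nagataAction c b) (AlgHom.id K _)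

variable {p : Fin n → Fin 3 → K} {m : Fin n → ℕ} {f : MvPolynomial (Fin n ⊕ Fin n) K}

theorem mem_nagataInvariants_iff :
    f ∈ nagataInvariants p m ↔ ∀ c : Fin n → Kˣ, ∏ i, c i ^ m i = 1 →
      ∀ b : Fin n → K, b ᵥ* Matrix.of p = 0 → nagataAction c b f = f := by
  simp only [nagataInvariants, Algebra.mem_iInf, AlgHom.mem_equalizer, AlgHom.id_apply]

theorem translationInvariant_of_mem_nagataInvariants (hf : f ∈ nagataInvariants p m) :
    TranslationInvariant p f := by
  intro u v b hb
  have hfix := mem_nagataInvariants_iff.mp hf 1 (by simp) b hb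
  rw [← congrArg (eval (Sum.elim u v)) hfix, nagataAction, eval_aeval]
  congr 2
  funext x
  rcases x with i | i <;> simp

theorem prod_pow_eq_of_mem_nagataInvariants (hf : f ∈ nagataInvariants p m)
    {μ : Fin n ⊕ Fin n →₀ ℕ} (hμ : μ ∈ f.support) {c : Fin n → Kˣ} (hc : ∏ i, c i ^ m i = 1) :
    ∏ i, c i ^ (μ (Sum.inl i) + μ (Sum.inr i)) = (∏ i, c i) ^ ∑ i, μ (Sum.inl i) := by
  set χ : Fin n ⊕ Fin n → Kˣ := Sum.elim (fun i => c i / ∏ j, c j) c with hχ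
  have haction : nagataAction c 0 = aeval (fun x => C (χ x : K) * X x) := by
    refine algHom_ext fun x => ?_
    rcases x with i | i <;> simp [nagataAction, χ, Units.val_div_eq_div_val]
  have hcoeff := congrArg (coeff μ)
    (mem_nagataInvariants_iff.mp hf c hc 0 (Matrix.zero_vecMul _))
  rw [haction, coeff_aeval_C_mul_X] at hcoeff
  have hK := (mul_eq_left₀ (mem_support_iff.mp hμ)).mp hcoeff
  have hχμ : ∏ x, χ x ^ μ x = 1 := by
    rw [Finsupp.prod_fintype _ _ fun _ => pow_zero _] at hK
    exact Units.ext (by push_cast; exact hK)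
  simp only [Fintype.prod_sum_type, hχ, Sum.elim_inl, Sum.elim_inr, div_pow,
    Finset.prod_div_distrib, Finset.prod_pow_eq_pow_sum] at hχμ
  rw [div_mul_eq_mul_div, div_eq_one] at hχμ
  simp only [pow_add, Finset.prod_mul_distrib]
  exact hχμ

theorem eq_zero_of_forall_units_zpow_eq_one [Infinite K] {N : ℤ} (h : ∀ s : Kˣ, s ^ N = 1) :
    N = 0 := by
  have hX : (Polynomial.X ^ (N.natAbs + 1) : Polynomial K) = Polynomial.X := by
    refine Polynomial.funext fun s => ?_
    rw [Polynomial.eval_pow, Polynomial.eval_X, pow_succ]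
    rcases eq_or_ne s 0 with rfl | hs
    · exact mul_zero _
    · rw [← Units.val_mk0 hs, ← Units.val_pow_eq_pow_val, pow_natAbs_eq_one.mpr (h _),
        Units.val_one, one_mul]
  simpa using congrArg Polynomial.natDegree hX

theorem mul_sub_eq_mul_sub_of_mem_nagataInvariants [Infinite K] (hf : f ∈ nagataInvariants p m)
    {μ : Fin n ⊕ Fin n →₀ ℕ} (hμ : μ ∈ f.support) (i j : Fin n) :
    (m j * ((∑ l, μ (Sum.inl l) : ℕ) - (μ (Sum.inl i) + μ (Sum.inr i) : ℕ)) : ℤ) =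
      m i * ((∑ l, μ (Sum.inl l) : ℕ) - (μ (Sum.inl j) + μ (Sum.inr j) : ℕ)) := by
  have hprod (x y : Kˣ) (e : Fin n → ℕ) :
      ∏ l, (Pi.mulSingle i x * Pi.mulSingle j y : Fin n → Kˣ) l ^ e l = x ^ e i * y ^ e j := by
    simp only [Pi.mul_apply, mul_pow, Finset.prod_mul_distrib]
    simp [Pi.mulSingle_apply, ite_pow]
  rw [← sub_eq_zero]
  refine eq_zero_of_forall_units_zpow_eq_one (K := K) fun s => ?_
  have htorus := prod_pow_eq_of_mem_nagataInvariants hf hμ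
    (c := Pi.mulSingle i (s ^ m j) * Pi.mulSingle j (s ^ m i)⁻¹)
    (by rw [hprod, inv_pow, ← pow_mul, ← pow_mul, mul_comm (m j), mul_inv_cancel])
  have hone := hprod (s ^ m j) (s ^ m i)⁻¹ 1
  simp only [Pi.one_apply, pow_one] at hone
  rw [hprod (s ^ m j) (s ^ m i)⁻¹ fun l => μ (Sum.inl l) + μ (Sum.inr l), hone] at htorus
  simp only [← zpow_natCast, ← zpow_mul, ← zpow_neg, ← zpow_add] at htorus
  rw [← mul_inv_eq_one.mpr htorus.symm, ← zpow_sub]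
  congr 1
  ring

theorem sum_mul_sub_eq_of_mem_nagataInvariants [Infinite K] (hf : f ∈ nagataInvariants p m)
    {μ : Fin n ⊕ Fin n →₀ ℕ} (hμ : μ ∈ f.support) (i : Fin n) :
    ((∑ j, m j : ℕ) * ((∑ l, μ (Sum.inl l) : ℕ) - (μ (Sum.inl i) + μ (Sum.inr i) : ℕ)) : ℤ) =
      (∑ j, ((∑ l, μ (Sum.inl l) : ℕ) - (μ (Sum.inl j) + μ (Sum.inr j) : ℕ) : ℤ)) * m i := by
  rw [Nat.cast_sum, Finset.sum_mul, Finset.sum_mul]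
  refine Finset.sum_congr rfl fun j _ => ?_
  rw [mul_sub_eq_mul_sub_of_mem_nagataInvariants hf hμ i j, mul_comm]

end Invariants

/-! ### Slopes of invariants -/

section Slopes

/-- The polynomials all of whose monomials have nonnegative weight. -/
def nonnegWeight (R : Type*) [CommSemiring R] {σ : Type*} (w : σ → ℝ) :
    Subalgebra R (MvPolynomial σ R) where
  carrier := {f | ∀ μ ∈ f.support, 0 ≤ Finsupp.weight w μ}
  mul_mem' := by
    classical
    intro f g hf hg μ hμ
    obtain ⟨a, ha, b, hb, rfl⟩ := Finset.mem_add.mp (support_mul f g hμ)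
    rw [map_add]
    exact add_nonneg (hf a ha) (hg b hb)
  add_mem' := by
    classical
    intro f g hf hg μ hμ
    exact (Finset.mem_union.mp (support_add hμ)).elim (hf μ) (hg μ)
  algebraMap_mem' := by
    intro r μ hμ
    obtain rfl : μ = 0 := by simpa using support_monomial_subset hμ
    rw [map_zero]

variable {K : Type*} [Field K] {n : ℕ} {p : Fin n → Fin 3 → K} {m : Fin n → ℕ}

/-- The grading of `K[u, v]` which, for an invariant defining a curve of degree `d` with
multiplicities `a`, has the value `(∑ mⱼ) d - θ ∑ aⱼ`: it is negative when the curve has a slope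
`d / ∑ aⱼ` less than `θ / ∑ mⱼ`. -/
def slopeWeight (m : Fin n → ℕ) (θ : ℝ) : Fin n ⊕ Fin n → ℝ :=
  Sum.elim (fun _ => (∑ j, m j : ℕ) - θ * (n - 1)) (fun _ => θ)

theorem weight_slopeWeight (θ : ℝ) (μ : Fin n ⊕ Fin n →₀ ℕ) :
    Finsupp.weight (slopeWeight m θ) μ = (∑ j, m j : ℕ) * (∑ l, μ (Sum.inl l) : ℕ) - θ *
      (∑ j, ((∑ l, μ (Sum.inl l) : ℕ) - (μ (Sum.inl j) + μ (Sum.inr j) : ℕ) : ℤ) : ℤ) := by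
  simp only [Finsupp.weight_eq_sum, Fintype.sum_sum_type, slopeWeight, Sum.elim_inl, Sum.elim_inr,
    nsmul_eq_mul, ← Finset.sum_mul, Finset.sum_sub_distrib, Finset.sum_const, Finset.card_univ,
    Fintype.card_fin]
  push_cast
  rw [Finset.sum_add_distrib]
  ring

open Filter Topology in
theorem eventually_weight_slopeWeight_nonneg [Infinite K]
    (h : IsGoodRay p (ray (deltaClass m)) ∨ IsWonderfulRay p (ray (deltaClass m)))
    {f : MvPolynomial (Fin n ⊕ Fin n) K} (hf : f ∈ nagataInvariants p m)
    {μ : Fin n ⊕ Fin n →₀ ℕ} (hμ : μ ∈ f.support) :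
    ∀ᶠ θ in 𝓝[>] (deltaClass m).1, 0 ≤ Finsupp.weight (slopeWeight m θ) μ := by
  have hsum := sum_mul_sub_eq_of_mem_nagataInvariants hf hμ
  simp only [weight_slopeWeight, sub_nonneg]
  rcases le_or_gt
    (∑ j, ((∑ l, μ (Sum.inl l) : ℕ) - (μ (Sum.inl j) + μ (Sum.inr j) : ℕ) : ℤ)) 0 with hA | hA
  · filter_upwards [self_mem_nhdsWithin] with θ hθ
    exact (mul_nonpos_of_nonneg_of_nonpos ((deltaClass_fst_nonneg m).trans hθ.le)
      (Int.cast_nonpos.mpr hA)).trans (by positivity)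
  · obtain ⟨Z, hZ⟩ := exists_leftInverse_points h
    obtain ⟨A, hAeq⟩ := Int.eq_ofNat_of_zero_le hA.le
    simp only [hAeq] at hsum hA ⊢
    have hlt := delta_mul_lt_of_effectiveClass h
      ((translationInvariant_of_mem_nagataInvariants hf).effectiveClass hZ hμ)
      (Int.natCast_pos.mp hA) fun j => (hsum j).ge
    have hcont : Tendsto (fun θ : ℝ => θ * A) (𝓝[>] (deltaClass m).1)
        (𝓝 ((deltaClass m).1 * A)) :=
      (Continuous.tendsto (by fun_prop) _).mono_left nhdsWithin_le_nhds
    filter_upwards [hcont.eventually_lt_const hlt] with θ hθ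
    exact_mod_cast hθ.le

theorem exists_nagataInvariants_le_nonnegWeight [Infinite K]
    (h : IsGoodRay p (ray (deltaClass m)) ∨ IsWonderfulRay p (ray (deltaClass m)))
    (hfin : Algebra.FiniteType K (nagataInvariants p m)) :
    ∃ θ, (deltaClass m).1 < θ ∧ nagataInvariants p m ≤ nonnegWeight K (slopeWeight m θ) := by
  obtain ⟨S, hS⟩ := (Subalgebra.fg_iff_finiteType _).mpr hfin
  have hgenerators : ∀ᶠ θ in nhdsWithin (deltaClass m).1 (Set.Ioi (deltaClass m).1),
      ∀ f ∈ S, ∀ μ ∈ f.support, 0 ≤ Finsupp.weight (slopeWeight m θ) μ := by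
    simp only [Filter.eventually_all_finset]
    exact fun f hf μ hμ =>
      eventually_weight_slopeWeight_nonneg h (hS ▸ Algebra.subset_adjoin hf) hμ
  obtain ⟨θ, hθ, hδθ⟩ := (hgenerators.and self_mem_nhdsWithin).exists
  exact ⟨θ, hδθ, hS ▸ Algebra.adjoin_le hθ⟩

end Slopes

/-! ### Invariants from plane curves -/

section PlaneInvariants

variable {K : Type*} [Field K] {n : ℕ} {p : Fin n → Fin 3 → K} {m : Fin n → ℕ}

/-- The linear forms `v₁ ⋯ vₙ ∑ⱼ pⱼᵢ uⱼ / vⱼ`, for `i = 0, 1, 2`, which Nagata's action fixes;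
forms in them recover the plane curves. -/
def planeInvariant (p : Fin n → Fin 3 → K) (i : Fin 3) : MvPolynomial (Fin n ⊕ Fin n) K :=
  ∑ j, p j i • (X (Sum.inl j) * ∏ l ∈ Finset.univ.erase j, X (Sum.inr l))

theorem nagataAction_planeInvariant (c : Fin n → Kˣ) {b : Fin n → K}
    (hb : b ᵥ* Matrix.of p = 0) (i : Fin 3) :
    nagataAction c b (planeInvariant p i) = planeInvariant p i := by
  have hterm (j : Fin n) :
      nagataAction c b (X (Sum.inl j) * ∏ l ∈ Finset.univ.erase j, X (Sum.inr l)) =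
        X (Sum.inl j) * ∏ l ∈ Finset.univ.erase j, X (Sum.inr l) +
          b j • ∏ l, X (Sum.inr l) := by
    have hc : (c j : K) / (∏ l, (c l : K)) * ∏ l ∈ Finset.univ.erase j, (c l : K) = 1 := by
      rw [div_mul_eq_mul_div, Finset.mul_prod_erase _ (fun l => (c l : K)) (Finset.mem_univ j),
        div_self (Finset.prod_ne_zero_iff.mpr fun l _ => (c l).ne_zero)]
    have hC := congrArg (C : K → MvPolynomial (Fin n ⊕ Fin n) K) hc
    rw [C_mul, C_1, map_prod] at hC
    simp only [nagataAction, map_mul, map_prod, aeval_X, Sum.elim_inl, Sum.elim_inr,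
      Finset.prod_mul_distrib]
    rw [smul_eq_C_mul,
      ← Finset.mul_prod_erase Finset.univ (fun l => X (Sum.inr l)) (Finset.mem_univ j)]
    linear_combination (X (Sum.inl j) + C (b j) * X (Sum.inr j)) *
      (∏ l ∈ Finset.univ.erase j, X (Sum.inr l)) * hC
  have hrel : ∑ j, p j i * b j = 0 := by
    simpa [Matrix.vecMul, dotProduct, mul_comm] using congrFun hb i
  simp only [planeInvariant, map_sum, map_smul, hterm, smul_add, Finset.sum_add_distrib,
    smul_smul, ← Finset.sum_smul, hrel, zero_smul, add_zero]

theorem nagataAction_prod_X_pow {c : Fin n → Kˣ} (hc : ∏ i, c i ^ m i = 1) (b : Fin n → K)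
    (t : ℕ) :
    nagataAction c b (∏ j, X (Sum.inr j) ^ (t * m j)) = ∏ j, X (Sum.inr j) ^ (t * m j) := by
  have hct : ∏ j, (c j : K) ^ (t * m j) = 1 := by
    simp only [mul_comm t, pow_mul, Finset.prod_pow]
    rw [← one_pow t, ← Units.val_one, ← hc]
    push_cast
    rfl
  simp only [nagataAction, map_prod, map_pow, aeval_X, Sum.elim_inr, mul_pow,
    Finset.prod_mul_distrib]
  simp only [← C_pow, ← map_prod]
  rw [hct, C_1, one_mul]

theorem X_pow_dvd_aeval_planeInvariant {f : MvPolynomial (Fin 3) K} {d r : ℕ}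
    (hf : f.IsHomogeneous d) {j : Fin n} (hr : HasMultAtLeast f (p j) r) :
    X (Sum.inr j) ^ r ∣ aeval (planeInvariant p) f := by
  set z : Fin 3 → MvPolynomial (Fin n ⊕ Fin n) K := fun i => ∑ l ∈ Finset.univ.erase j,
    p l i • (X (Sum.inl l) * ∏ l' ∈ Finset.univ.erase l, X (Sum.inr l'))
  have hsplit : planeInvariant p = fun i =>
      p j i • (X (Sum.inl j) * ∏ l ∈ Finset.univ.erase j, X (Sum.inr l)) + z i := by
    funext i
    rw [planeInvariant, ← Finset.add_sum_erase _ _ (Finset.mem_univ j)]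
  rw [← Ideal.mem_span_singleton, ← Ideal.span_singleton_pow, hsplit]
  refine aeval_smul_add_mem_pow hf _ _ (fun i => sum_mem fun l hl => ?_)
    fun e he => Or.inl (hr e he)
  refine Submodule.smul_of_tower_mem _ _ (Ideal.mul_mem_left _ _ (Ideal.mem_span_singleton.mpr ?_))
  exact Finset.dvd_prod_of_mem (fun l => X (Sum.inr l))
    (Finset.mem_erase.mpr ⟨(Finset.ne_of_mem_erase hl).symm, Finset.mem_univ j⟩)

theorem prod_X_pow_dvd_aeval_planeInvariant {f : MvPolynomial (Fin 3) K} {d : ℕ}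
    (hf : f.IsHomogeneous d) {r : Fin n → ℕ} (hr : ∀ j, HasMultAtLeast f (p j) (r j)) :
    ∏ j, X (Sum.inr j) ^ r j ∣ aeval (planeInvariant p) f := by
  refine Finset.prod_dvd_of_isRelPrime (fun i _ j _ hij => IsRelPrime.pow ?_)
    fun j _ => X_pow_dvd_aeval_planeInvariant hf (hr j)
  refine (Irreducible.isRelPrime_iff_not_dvd (X_prime (i := _)).irreducible).mpr ?_
  rw [X_dvd_X]
  exact fun h => hij (Sum.inr_injective h)

theorem aeval_planeInvariant_ne_zero {Z : Matrix (Fin 3) (Fin n) K} (hZ : Z * Matrix.of p = 1)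
    {f : MvPolynomial (Fin 3) K} (hf : f ≠ 0) : aeval (planeInvariant p) f ≠ 0 := by
  have hsection (i : Fin 3) : curveForm Z (planeInvariant p i) = X i := by
    have hZi (i' : Fin 3) : ∑ j, p j i * Z i' j = if i' = i then 1 else 0 := by
      simpa [Matrix.mul_apply, Matrix.one_apply, mul_comm] using congrFun (congrFun hZ i') i
    simp only [curveForm, planeInvariant, map_sum, map_smul, map_mul, map_prod, aeval_X,
      Sum.elim_inl, Sum.elim_inr, Pi.one_apply, Finset.prod_const_one, mul_one, Finset.smul_sum]
    rw [Finset.sum_comm]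
    simp only [C_mul', smul_smul, ← Finset.sum_smul, hZi, ite_smul, one_smul, zero_smul,
      Finset.sum_ite_eq', Finset.mem_univ, if_true]
  intro h0
  refine hf ?_
  have hcurve : curveForm Z (aeval (planeInvariant p) f) = f := by
    rw [curveForm, ← AlgHom.comp_apply, comp_aeval]
    exact (congrArg (aeval · f) (funext hsection)).trans (aeval_X_left_apply f)
  rw [← hcurve, h0, curveForm, map_zero]

theorem isWeightedHomogeneous_planeInvariant (θ : ℝ) (i : Fin 3) :
    IsWeightedHomogeneous (slopeWeight m θ) (planeInvariant p i) (∑ j, m j : ℕ) := by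
  refine IsWeightedHomogeneous.sum _ _ _ fun j _ =>
    (weightedHomogeneousSubmodule K _ _).smul_mem _ ?_
  have hweight : ((∑ j, m j : ℕ) : ℝ) = slopeWeight m θ (Sum.inl j) +
      ∑ l ∈ Finset.univ.erase j, slopeWeight m θ (Sum.inr l) := by
    simp only [slopeWeight, Sum.elim_inl, Sum.elim_inr, Finset.sum_const, nsmul_eq_mul,
      Finset.card_erase_of_mem (Finset.mem_univ j), Finset.card_univ, Fintype.card_fin]
    push_cast [j.pos]
    ring
  rw [hweight]
  exact (isWeightedHomogeneous_X K _ _).mul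
    (IsWeightedHomogeneous.prod _ _ _ fun l _ => isWeightedHomogeneous_X K _ _)

theorem isWeightedHomogeneous_of_monomial_mul {σ R M : Type*} [CommSemiring R]
    [AddCancelCommMonoid M] {w : σ → M} {s : σ →₀ ℕ} {q : MvPolynomial σ R} {d : M}
    (h : IsWeightedHomogeneous w (monomial s 1 * q) (Finsupp.weight w s + d)) :
    IsWeightedHomogeneous w q d := by
  intro μ hμ
  refine add_left_cancel (a := Finsupp.weight w s) ?_
  rw [← map_add]
  exact h (by rwa [coeff_monomial_mul, one_mul])

theorem isWeightedHomogeneous_of_prod_mul_eq_aeval_planeInvariant {f : MvPolynomial (Fin 3) K}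
    {d t : ℕ} (hf : f.IsHomogeneous d) {q : MvPolynomial (Fin n ⊕ Fin n) K}
    (hq : (∏ j, X (Sum.inr j) ^ (t * m j)) * q = aeval (planeInvariant p) f) (θ : ℝ) :
    IsWeightedHomogeneous (slopeWeight m θ) q ((∑ j, m j : ℕ) * (d - θ * t)) := by
  have hf' : IsWeightedHomogeneous (fun _ => ((∑ j, m j : ℕ) : ℝ)) f
      ((∑ j, m j : ℕ) * d : ℝ) := by
    intro ν hν
    rw [← hf hν]
    simp [Finsupp.weight_eq_sum, Finset.mul_sum, mul_comm]
  have hhom := aeval_isWeightedHomogeneous hf'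
    (isWeightedHomogeneous_planeInvariant (p := p) (m := m) θ)
  have hweight : Finsupp.weight (slopeWeight m θ) (∑ j, Finsupp.single (Sum.inr j) (t * m j)) +
      (∑ j, m j : ℕ) * (d - θ * t) = (∑ j, m j : ℕ) * d := by
    simp only [map_sum, Finsupp.weight_single, slopeWeight, Sum.elim_inr, nsmul_eq_mul]
    push_cast
    rw [← Finset.sum_mul, ← Finset.mul_sum]
    ring
  refine isWeightedHomogeneous_of_monomial_mul
    (s := ∑ j, Finsupp.single (Sum.inr j) (t * m j)) ?_
  rw [hweight, monomial_sum_one]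
  simpa only [← X_pow_eq_monomial, hq] using hhom

theorem exists_mem_nagataInvariants {Z : Matrix (Fin 3) (Fin n) K} (hZ : Z * Matrix.of p = 1)
    {d t : ℕ} (h : EffectiveClass p d (fun j => ((t * m j : ℕ) : ℤ))) :
    ∃ q ∈ nagataInvariants p m, q ≠ 0 ∧ ∀ θ,
      IsWeightedHomogeneous (slopeWeight m θ) q ((∑ j, m j : ℕ) * (d - θ * t)) := by
  obtain ⟨d', f, hd, hf0, hf, hmult⟩ := h
  obtain rfl : d' = d := Nat.cast_injective hd
  obtain ⟨q, hq⟩ := prod_X_pow_dvd_aeval_planeInvariant hf hmult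
  simp only [Int.toNat_natCast] at hq
  have hfq0 := aeval_planeInvariant_ne_zero hZ hf0
  rw [hq] at hfq0
  refine ⟨q, mem_nagataInvariants_iff.mpr fun c hc b hb => ?_, right_ne_zero_of_mul hfq0,
    isWeightedHomogeneous_of_prod_mul_eq_aeval_planeInvariant hf hq.symm⟩
  have hfix : nagataAction c b (aeval (planeInvariant p) f) = aeval (planeInvariant p) f := by
    rw [← AlgHom.comp_apply, comp_aeval]
    simp only [nagataAction_planeInvariant c hb]
  rw [hq, map_mul, nagataAction_prod_X_pow hc] at hfix
  exact mul_left_cancel₀ (left_ne_zero_of_mul hfq0) hfix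

end PlaneInvariants

/-! ### Infinite generation -/

section InfiniteGeneration

variable {K : Type*} [Field K] {n : ℕ} {p : Fin n → Fin 3 → K} {m : Fin n → ℕ}

theorem sum_pos_of_isGoodRay_or_isWonderfulRay
    (h : IsGoodRay p (ray (deltaClass m)) ∨ IsWonderfulRay p (ray (deltaClass m))) :
    0 < ∑ j, m j := by
  by_contra hM
  have hm (j : Fin n) : m j = 0 :=
    Finset.sum_eq_zero_iff.mp (Nat.eq_zero_of_not_pos hM) j (Finset.mem_univ j)
  have hconst : EffectiveClass p 0 0 :=
    ⟨0, 1, rfl, one_ne_zero, isHomogeneous_one _ _, fun _ => hasMultAtLeast_zero⟩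
  have hlt := delta_mul_lt_of_effectiveClass h hconst (N := 0) one_pos fun j => by simp [hm j]
  push_cast at hlt
  linarith [deltaClass_fst_nonneg m]

theorem mainTheorem2_general [Infinite K] (hp : ∀ j, p j ≠ 0)
    (h : IsGoodRay p (ray (deltaClass m)) ∨ IsWonderfulRay p (ray (deltaClass m))) :
    ¬ Algebra.FiniteType K (nagataInvariants p m) := by
  intro hfin
  obtain ⟨θ, hδθ, hnonneg⟩ := exists_nagataInvariants_le_nonnegWeight h hfin
  obtain ⟨t, d, hdt, hda⟩ := exists_effectiveClass_lt hp m hδθ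
  obtain ⟨Z, hZ⟩ := exists_leftInverse_points h
  obtain ⟨q, hq, hq0, hweight⟩ := exists_mem_nagataInvariants hZ hda
  obtain ⟨μ, hμ⟩ := ne_zero_iff.mp hq0
  have hμ_nonneg := hnonneg hq μ (mem_support_iff.mpr hμ)
  have hM : (0 : ℝ) < (∑ j, m j : ℕ) :=
    Nat.cast_pos.mpr (sum_pos_of_isGoodRay_or_isWonderfulRay h)
  rw [hweight θ hμ] at hμ_nonneg
  linarith [nonneg_of_mul_nonneg_right hμ_nonneg hM]

end InfiniteGeneration

/-! ### Generic and very general points -/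

section GenericPoints

theorem dense_setOf_eval_ne_zero {σ 𝕜 : Type*} [Finite σ] [NontriviallyNormedField 𝕜]
    {g : MvPolynomial σ 𝕜} (hg : g ≠ 0) : Dense {x : σ → 𝕜 | eval x g ≠ 0} := by
  cases nonempty_fintype σ
  intro x
  rw [mem_closure_iff]
  intro U hU hx
  by_contra hempty
  obtain ⟨u, hu, hsub⟩ := isOpen_pi_iff'.mp hU x hx
  refine hg (funext_set u (fun i => infinite_of_mem_nhds (x i) ((hu i).1.mem_nhds (hu i).2))
    fun y hy => ?_)
  by_contra hy0
  exact hempty ⟨y, hsub hy, by simpa using hy0⟩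

theorem exists_forall_eval_ne_zero {σ 𝕜 : Type*} [Finite σ] [NontriviallyNormedField 𝕜]
    [CompleteSpace 𝕜] {S : Set (MvPolynomial σ 𝕜)} (hS : S.Countable) (h0 : 0 ∉ S) :
    ∃ x : σ → 𝕜, ∀ g ∈ S, eval x g ≠ 0 := by
  cases nonempty_fintype σ
  have hdense : Dense (⋂ g ∈ S, {x : σ → 𝕜 | eval x g ≠ 0}) :=
    dense_biInter_of_isOpen
      (fun g _ => isOpen_ne_fun (MvPolynomial.continuous_eval g) continuous_const) hS
      (fun g hg => dense_setOf_eval_ne_zero fun h => h0 (h ▸ hg))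
  obtain ⟨x, hx⟩ := hdense.nonempty
  exact ⟨x, Set.mem_iInter₂.mp hx⟩

theorem ForVeryGeneral.exists_eval_ne_zero {n : ℕ} {P : (Fin n → Fin 3 → ℂ) → Prop}
    (h : ForVeryGeneral n P) {g : MvPolynomial (Fin 3 × Fin n) ℂ} (hg : g ≠ 0) :
    ∃ p, eval (fun ij => p ij.2 ij.1) g ≠ 0 ∧ P p := by
  obtain ⟨S, hS, h0, hP⟩ := h
  obtain ⟨x, hx⟩ := exists_forall_eval_ne_zero (hS.insert g)
    (by rw [Set.mem_insert_iff, not_or]; exact ⟨hg.symm, h0⟩)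
  exact ⟨fun j i => x (i, j), hx g (Set.mem_insert _ _),
    hP _ fun g' hg' => hx g' (Set.mem_insert_of_mem _ hg')⟩

theorem map_translate {σ R S : Type*} [CommRing R] [CommRing S] (φ : R →+* S) (x : σ → R)
    (q : MvPolynomial σ R) : map φ (translate x q) = translate (φ ∘ x) (map φ q) := by
  refine (map_bind₁ φ _ q).trans ?_
  simp only [map_add, map_X, map_C]
  rfl

theorem exists_map_eq_C_mul {B L σ : Type*} [CommRing B] [IsDomain B] [Field L] [Algebra B L]
    [IsFractionRing B L] (f : MvPolynomial σ L) :
    ∃ b : B, b ≠ 0 ∧ ∃ f₀ : MvPolynomial σ B,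
      map (algebraMap B L) f₀ = C (algebraMap B L b) * f := by
  let : Algebra (MvPolynomial σ B) (MvPolynomial σ L) := algebraMvPolynomial
  obtain ⟨⟨f₀, ⟨_, b, hb, rfl⟩⟩, hf₀⟩ :=
    IsLocalization.surj ((nonZeroDivisors B).map (C : B →+* MvPolynomial σ B)) f
  refine ⟨b, nonZeroDivisors.ne_zero hb, f₀, ?_⟩
  rw [mul_comm]
  simpa using hf₀.symm

theorem EffectiveClass.exists_specialization {F : Type*} [Field F] {n : ℕ} {d : ℤ}
    {a : Fin n → ℤ} (h : EffectiveClass (genericPoints F n) d a) :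
    ∃ g : MvPolynomial (Fin 3 × Fin n) F, g ≠ 0 ∧ ∀ p : Fin n → Fin 3 → F,
      eval (fun ij => p ij.2 ij.1) g ≠ 0 → EffectiveClass p d a := by
  obtain ⟨e, f, rfl, hf0, hf, hmult⟩ := h
  set B := MvPolynomial (Fin 3 × Fin n) F
  have hinj : Function.Injective (algebraMap B (GenericField F n)) :=
    IsFractionRing.injective B (GenericField F n)
  obtain ⟨b, hb, f₀, hmap⟩ := exists_map_eq_C_mul (B := B) f
  have hf₀ : f₀ ≠ 0 := by
    rintro rfl
    rw [map_zero] at hmap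
    exact mul_ne_zero ((map_ne_zero_iff _ (C_injective _ _)).mpr
      ((map_ne_zero_iff _ hinj).mpr hb)) hf0 hmap.symm
  obtain ⟨s, hs⟩ := ne_zero_iff.mp hf₀
  refine ⟨coeff s f₀, hs, fun p hp => ?_⟩
  set ev : B →+* F := eval (fun ij => p ij.2 ij.1)
  refine ⟨e, map ev f₀, rfl, ne_zero_iff.mpr ⟨s, by rwa [coeff_map]⟩,
    (IsHomogeneous.of_map hinj (hmap ▸ hf.C_mul _)).map ev, fun j μ hμ => ?_⟩
  set x : Fin 3 → B := fun i => X (i, j)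
  have hgeneric : coeff μ (translate x f₀) = 0 := by
    refine hinj ?_
    rw [← coeff_map, map_translate, hmap, map_mul, translate, algHom_C, algebraMap_eq,
      coeff_C_mul, map_zero]
    exact mul_eq_zero_of_right _ (hmult j μ hμ)
  have hx : ev ∘ x = p j := _root_.funext fun i => eval_X _
  have hspecial := congrArg ev hgeneric
  rwa [← coeff_map, map_translate, map_zero, hx] at hspecial

theorem ForVeryGeneral.exists_effectiveClass {n : ℕ} {P : (Fin n → Fin 3 → ℂ) → Prop}
    (h : ForVeryGeneral n P) {d : ℤ} {a : Fin n → ℤ}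
    (hda : EffectiveClass (genericPoints ℂ n) d a) : ∃ p, P p ∧ EffectiveClass p d a := by
  obtain ⟨g, hg, hspecialize⟩ := hda.exists_specialization
  obtain ⟨p, hgp, hP⟩ := h.exists_eval_ne_zero hg
  exact ⟨p, hP, hspecialize p hgp⟩

theorem ForVeryGeneral.genericPoints {n : ℕ} {ρ : Set (N1 n)}
    (h : ForVeryGeneral n fun p => IsGoodRay p ρ ∨ IsWonderfulRay p ρ) :
    IsGoodRay (genericPoints ℂ n) ρ ∨ IsWonderfulRay (genericPoints ℂ n) ρ := by
  obtain ⟨p₀, -, hp₀⟩ := h.exists_eval_ne_zero one_ne_zero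
  have hray : IsRay ρ := hp₀.elim And.left And.left
  have hfrontier : ρ ⊆ frontier (nonnegCone n) := hp₀.elim (·.2.1) (·.2.1)
  by_cases hrational : RationalRay ρ
  · refine Or.inl ⟨hray, hfrontier, hrational, fun ⟨d, a, hda, hρ⟩ => ?_⟩
    obtain ⟨p, hp, hpda⟩ := h.exists_effectiveClass hda
    exact (hp.resolve_right fun hw => hw.2.2.1 hrational).2.2.2 ⟨d, a, hpda, hρ⟩
  · refine Or.inr ⟨hray, hfrontier, hrational, fun ξ hξ d a hda => ?_⟩
    obtain ⟨p, hp, hpda⟩ := h.exists_effectiveClass hda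
    exact (hp.resolve_left fun hg => hrational hg.2.2.1).2.2.2 ξ hξ d a hpda

variable (F : Type*) [Field F] {n : ℕ}

theorem genericPoints_ne_zero (j : Fin n) : genericPoints F n j ≠ 0 :=
  Function.ne_iff.mpr ⟨0, by simp [genericPoints, genericMatrix]⟩

theorem infinite_genericField [Nonempty (Fin n)] : Infinite (GenericField F n) :=
  Infinite.of_injective _ (IsFractionRing.injective (MvPolynomial (Fin 3 × Fin n) F) _)

theorem invariantRing_eq_nagataInvariants (m : Fin n → ℕ) :
    invariantRing F m = nagataInvariants (genericPoints F n) m := by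
  have hV (b : Fin n → GenericField F n) :
      b ∈ subspaceV F n ↔ b ᵥ* Matrix.of (genericPoints F n) = 0 := by
    rw [show Matrix.of (genericPoints F n) = (genericMatrix F n)ᵀ from rfl, Matrix.vecMul_transpose]
    rfl
  ext f
  simp only [mem_nagataInvariants_iff, ← hV]
  rfl

variable {F}

theorem not_finiteType_invariantRing {m : Fin n → ℕ}
    (h : IsGoodRay (genericPoints F n) (ray (deltaClass m)) ∨
      IsWonderfulRay (genericPoints F n) (ray (deltaClass m))) :
    ¬ Algebra.FiniteType (GenericField F n) (invariantRing F m) := by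
  obtain ⟨j, -, -⟩ := Finset.sum_pos_iff.mp (sum_pos_of_isGoodRay_or_isWonderfulRay h)
  have : Nonempty (Fin n) := ⟨j⟩
  have := infinite_genericField F (n := n)
  rw [invariantRing_eq_nagataInvariants]
  exact mainTheorem2_general (genericPoints_ne_zero F) h

end GenericPoints

end NagataRays

end

open NagataRays in
theorem mainTheorem2 {n : ℕ} (m : Fin n → ℕ) (hm : ∀ i, 0 < m i) :
    (∀ (F : Type*) [Field F],
      (IsGoodRay (genericPoints F n) (ray (deltaClass m)) ∨
        IsWonderfulRay (genericPoints F n) (ray (deltaClass m))) →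
      ¬ Algebra.FiniteType (GenericField F n) (invariantRing F m)) ∧
    (ForVeryGeneral n (fun p =>
        IsGoodRay p (ray (deltaClass m)) ∨ IsWonderfulRay p (ray (deltaClass m))) →
      ¬ Algebra.FiniteType (GenericField ℂ n) (invariantRing ℂ m)) :=
  ⟨fun _ _ h => not_finiteType_invariantRing h,
    fun h => not_finiteType_invariantRing h.genericPoints⟩
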